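/- Let $n,d\ge 1$ be integers. Let $\mathfrak{gl}_d$ be the space of complex $d\times d$ matrices and $\mathfrak{gl}_d^{rs}\subset\mathfrak{gl}_d$ the open subset of diagonalizable matrices with pairwise distinct eigenvalues. Let $\mathcal F$ be the space of $n$-step partial flags $F=(0=F_0\subseteq F_1\subseteq\dots\subseteq F_n=\mathbb C^d)$ (inclusions not necessarily proper), let $M^\perp=\{(x,F)\in\mathfrak{gl}_d\times\mathcal F \mid x(F_j)\subseteq F_j \text{ for all } j\}$, and let $\tilde\mu:M^\perp\to\mathfrak{gl}_d$, $(x,F)\mapsto x$. Then the sheaf $\mathcal L=\tilde\mu_*\mathbb C_{M^\perp}|_{\mathfrak{gl}_d^{rs}}$ is a local system. Let $x\in\mathfrak{gl}_d^{rs}$, and let $e_1,\dots,e_d$ be a basis of $\mathbb C^d$ with $xe_i=\lambda_ie_i$. For $\varphi:\{1,\dots,d\}\to\{1,\dots,n\}$ let $F^\varphi\in\tilde\mu^{-1}(x)$ be the flag with $F^\varphi_j=\operatorname{span}\{e_i\mid \varphi(i)\le j\}$. For every basis $f_1,\dots,f_n$ of $\mathbb C^n$ there is a linear isomorphism $$T:\mathcal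 L_x\to(\mathbb C^n)^{\otimes d},\qquad T(s_x)=\sum_{\varphi} s(x,F^\varphi)\, f_{\varphi(1)}\otimes\dots\otimes f_{\varphi(d)},$$ where $s_x$ is the germ at $x$ of a section $s$ of $\mathcal L$ near $x$, that is, of a locally constant function on the preimage under $\tilde\mu$ of a neighbourhood of $x$. Under this identification, the monodromy action of $\pi_1(\mathfrak{gl}_d^{rs},x)$ on $\mathcal L_x\cong(\mathbb C^n)^{\otimes d}$ factors through the natural representation of the symmetric group $S_d$, $\sigma(v_1\otimes\dots\otimes v_d)=v_{\sigma^{-1}(1)}\otimes\dots\otimes v_{\sigma^{-1}(d)}$: there is a surjective group homomorphism $\rho:\pi_1(\mathfrak{gl}_d^{rs},x)\to S_d$, independent of the choice of $f_1,\dots,f_n$, such that $T(\gamma\cdot a)=\rho(\gamma)\,T(a)$ for all $\gamma\in\pi_1(\mathfrak{gl}_d^{rs},x)$ and $a\in\mathcal L_x$. Here $\rho$ is the permutation of the eigenvalues of $x$ along loops: for every loop $\gamma$ at $x$ and every $i$, some continuous function $l:[0,1]\to\mathbb C$ with $l(t)$ an eigenvalue of $\gamma(t)$ for all $t$ satisfies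 $l(0)=\lambda_i$ and $l(1)=\lambda_{\rho(\gamma)(i)}$. (Products in $\pi_1$ are ordered so that $\gamma\gamma'$ means first $\gamma'$, then $\gamma$.) -/

import Mathlib

open CategoryTheory TopologicalSpace Opposite
open scoped TensorProduct

noncomputable section

namespace FlagMonodromy

/-- The constant sheaf `V_X`: its sections over an open `U` are the locally constant functions
`U → V`. -/
def constPresheaf (X : TopCat.{0}) (V : ModuleCat.{0} ℂ) : TopCat.Presheaf (ModuleCat.{0} ℂ) X where
  obj U := ModuleCat.of ℂ (LocallyConstant (U.unop : Opens X) V)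
  map {U W} i := ModuleCat.ofHom
    (LocallyConstant.comapₗ ℂ ⟨Set.inclusion i.unop.le, continuous_inclusion i.unop.le⟩)
  map_id U := by
    ext s
    rfl
  map_comp i j := by
    ext s
    rfl

theorem constPresheaf_isSheaf (X : TopCat.{0}) (V : ModuleCat.{0} ℂ) :
    (constPresheaf X V).IsSheaf := by
  rw [TopCat.Presheaf.isSheaf_iff_isSheafUniqueGluing]
  intro ι U sf hsf
  let g : ∀ i : ι, LocallyConstant (U i : Opens X) V := sf
  have key : ∀ (i j : ι) (x : X) (hi : x ∈ U i) (hj : x ∈ U j), g i ⟨x, hi⟩ = g j ⟨x, hj⟩ := by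
    intro i j x hi hj
    exact DFunLike.congr_fun (F := LocallyConstant (U i ⊓ U j : Opens X) V) (hsf i j) ⟨x, hi, hj⟩
  have hm : ∀ x : (iSup U : Opens X), ∃ i, (x : X) ∈ U i := fun x => Opens.mem_iSup.1 x.2
  choose k hk using hm
  refine ⟨(⟨fun x => g (k x) ⟨x, hk x⟩, ?_⟩ : LocallyConstant (iSup U : Opens X) V), ?_, ?_⟩
  · rw [IsLocallyConstant.iff_exists_open]
    intro x
    obtain ⟨W, hW, hxW, hWc⟩ := (g (k x)).isLocallyConstant.exists_open ⟨x, hk x⟩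
    obtain ⟨W', hW', rfl⟩ := isOpen_induced_iff.1 hW
    refine ⟨Subtype.val ⁻¹' (W' ∩ U (k x)),
      (hW'.inter (U (k x)).isOpen).preimage continuous_subtype_val, ⟨hxW, hk x⟩, ?_⟩
    rintro y ⟨hy, hy'⟩
    exact (key _ _ _ _ _).trans (hWc ⟨y, hy'⟩ hy)
  · intro i
    refine LocallyConstant.ext (X := (U i : Opens X)) (Y := V) fun x => ?_
    exact key _ _ _ _ _
  · intro t ht
    refine LocallyConstant.ext (X := (iSup U : Opens X)) (Y := V) fun x => ?_
    exact DFunLike.congr_fun (F := LocallyConstant (U (k x) : Opens X) V) (ht (k x)) ⟨x, hk x⟩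

/-- The constant sheaf on `X` with stalk the complex vector space `V`. -/
def constSheaf (X : TopCat.{0}) (V : ModuleCat.{0} ℂ) : X.Sheaf (ModuleCat.{0} ℂ) :=
  ⟨constPresheaf X V, constPresheaf_isSheaf X V⟩

/-- A local system: a sheaf of complex vector spaces which is locally isomorphic to a constant
sheaf with finite-dimensional stalk. -/
def IsLocalSystem {X : TopCat.{0}} (F : X.Sheaf (ModuleCat.{0} ℂ)) : Prop :=
  ∀ x : X, ∃ U : Opens X, x ∈ U ∧ ∃ V : ModuleCat.{0} ℂ, Module.Finite ℂ V ∧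
    Nonempty (U.sheafRestrict.obj F ≅ constSheaf (TopCat.of U) V)


/-- The étalé space of a local system is a covering of the base. -/
theorem IsLocalSystem.isCoveringMap {X : TopCat.{0}} [LocallyConnectedSpace X]
    {F : X.Sheaf (ModuleCat.{0} ℂ)} (hF : IsLocalSystem F) :
    IsCoveringMap (TopCat.Presheaf.EtaleSpace.base (F := F.presheaf)) := by
  refine TopCat.Presheaf.EtaleSpace.isCoveringMap_base fun x => ?_
  obtain ⟨U, hxU, V, -, ⟨e⟩⟩ := hF x
  obtain ⟨W, hWU, hW, hxW, hWc⟩ :=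
    locallyConnectedSpace_iff_subsets_isOpen_isConnected.1 ‹_› x U (U.isOpen.mem_nhds hxU)
  let j : Opens U ⥤ Opens X := U.isOpenEmbedding.isOpenMap.functor
  let e' : j.op ⋙ F.presheaf ≅ constPresheaf (TopCat.of U) V :=
    (sheafToPresheaf _ _).mapIso e
  let r (N : Opens X) : Opens U := ⟨Subtype.val ⁻¹' N, N.isOpen.preimage continuous_subtype_val⟩
  let W0 : Opens U := r ⟨W, hW⟩
  have hW0 : IsPreconnected (W0 : Set U) := by
    rw [← Topology.IsInducing.subtypeVal.isPreconnected_image]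
    have : (Subtype.val '' (W0 : Set U) : Set X) = W := by
      ext z
      exact ⟨by rintro ⟨u, hu, rfl⟩; exact hu, fun hz => ⟨⟨z, hWU hz⟩, hz, rfl⟩⟩
    exact this ▸ hWc.isPreconnected
  have hjr : ∀ N : Opens X, j.obj (r N) ≤ N := by
    rintro N _ ⟨u, hu, rfl⟩
    exact hu
  -- the locally constant function attached to a section
  let f (N : Opens U) (s : F.presheaf.obj (op (j.obj N))) : LocallyConstant N V :=
    e'.hom.app (op N) s
  have hf : ∀ N : Opens U, Function.Injective (f N) := fun N =>
    (ConcreteCategory.bijective_of_isIso (e'.hom.app (op N))).1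
  have hfs : ∀ N : Opens U, Function.Surjective (f N) := fun N =>
    (ConcreteCategory.bijective_of_isIso (e'.hom.app (op N))).2
  have hnat : ∀ (N M : Opens U) (i : N ⟶ M) (s : F.presheaf.obj (op (j.obj M))) (z : N),
      f N (F.presheaf.map (j.map i).op s) z = f M s ⟨z, i.le z.2⟩ := by
    intro N M i s z
    have := ConcreteCategory.congr_hom (e'.hom.naturality i.op) s
    exact DFunLike.congr_fun (F := LocallyConstant N V) this z
  refine ⟨j.obj W0, ⟨⟨x, hxU⟩, hxW, rfl⟩, ?_⟩
  rintro _ ⟨y, hy, rfl⟩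
  constructor
  · intro s t hst
    obtain ⟨N, hyN, i₁, i₂, hN⟩ := F.presheaf.germ_eq _ _ _ _ _ hst
    have hNW : r N ≤ W0 := by
      intro z hz
      obtain ⟨z', hz', hzz⟩ := i₁.le hz
      rwa [← Subtype.ext hzz]
    have h1 : F.presheaf.map (j.map (homOfLE hNW)).op s
        = F.presheaf.map (j.map (homOfLE hNW)).op t := by
      have := congrArg (F.presheaf.map (homOfLE (hjr N)).op) hN
      rw [← ConcreteCategory.comp_apply, ← ConcreteCategory.comp_apply, ← Functor.map_comp,
        ← Functor.map_comp] at this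
      exact this
    have h2 : f W0 s ⟨y, hy⟩ = f W0 t ⟨y, hy⟩ := by
      have := hnat _ _ (homOfLE hNW) s ⟨y, hyN⟩
      rw [h1, hnat] at this
      exact this.symm
    have : PreconnectedSpace W0 := Subtype.preconnectedSpace hW0
    refine hf _ (LocallyConstant.ext fun z => ?_)
    rw [(f W0 s).apply_eq_of_preconnectedSpace z ⟨y, hy⟩,
      (f W0 t).apply_eq_of_preconnectedSpace z ⟨y, hy⟩, h2]
  · intro a
    obtain ⟨N, hNW, hyN, s, rfl⟩ := F.presheaf.exists_le_germ_eq a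
      (V := j.obj W0) ⟨y, hy, rfl⟩
    have hrN : r N ≤ W0 := by
      intro z hz
      obtain ⟨z', hz', hzz⟩ := hNW hz
      rwa [← Subtype.ext hzz]
    let s1 := F.presheaf.map (homOfLE (hjr N)).op s
    obtain ⟨Q, hQ, hyQ, hQc⟩ := (f (r N) s1).isLocallyConstant.exists_open ⟨y, hyN⟩
    obtain ⟨Q', hQ', rfl⟩ := isOpen_induced_iff.1 hQ
    obtain ⟨t, ht⟩ := hfs W0 (LocallyConstant.const _ (f (r N) s1 ⟨y, hyN⟩))
    refine ⟨t, ?_⟩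
    let Q0 : Opens U := ⟨Q', hQ'⟩ ⊓ r N
    have hQN : Q0 ≤ r N := inf_le_right
    refine F.presheaf.germ_ext (j.obj Q0) ⟨y, ⟨hyQ, hyN⟩, rfl⟩ (j.map (homOfLE (hQN.trans hrN)))
      (j.map (homOfLE hQN) ≫ homOfLE (hjr N)) ?_
    have h3 : F.presheaf.map (j.map (homOfLE hQN) ≫ homOfLE (hjr N)).op s
        = F.presheaf.map (j.map (homOfLE hQN)).op s1 := by
      rw [op_comp, Functor.map_comp, ConcreteCategory.comp_apply]
    rw [h3]
    refine hf _ (LocallyConstant.ext fun z => ?_)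
    rw [hnat, hnat, ht]
    exact (hQc ⟨z, z.2.2⟩ z.2.1).symm

/-- The fibre of the étalé space over `x` is the stalk at `x`. -/
def fiberEquivStalk {X : TopCat.{0}} (F : X.Sheaf (ModuleCat.{0} ℂ)) (x : X) :
    (TopCat.Presheaf.EtaleSpace.base (F := F.presheaf)) ⁻¹' {x} ≃ F.presheaf.stalk x where
  toFun p := cast (congrArg (fun y => (F.presheaf.stalk y : Type)) p.2) p.1.germ
  invFun s := ⟨⟨x, s⟩, rfl⟩
  left_inv := by
    rintro ⟨⟨y, s⟩, hy⟩
    obtain rfl : y = x := hy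
    rfl
  right_inv s := rfl

/-- The monodromy action of the fundamental group on the stalk of a local system: a loop acts by
continuing germs along it, i.e. by lifting it to the étalé space. The product `γ * γ'` in
`FundamentalGroup` is the class of the path which first follows `γ'` and then `γ`, so this is a
left action. -/
def monodromyAction {X : TopCat.{0}} [LocallyConnectedSpace X]
    {F : X.Sheaf (ModuleCat.{0} ℂ)} (hF : IsLocalSystem F) (x : X) :
    FundamentalGroup X x →* Equiv.Perm (F.presheaf.stalk x) :=
  (fiberEquivStalk F x).permCongrHom.toMonoidHom.comp (hF.isCoveringMap.monodromyPerm x)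

/-- The Lie algebra `gl_d` of complex `d × d` matrices, with its usual topology. -/
abbrev gl (d : ℕ) : Type := Matrix (Fin d) (Fin d) ℂ
/-- The space `ℂ^d`; the inner product is used only to describe the topology on flags. -/
abbrev Cd (d : ℕ) : Type := EuclideanSpace ℂ (Fin d)

/-- A basis of `ℂ^d` in which `x` is diagonal. -/
structure EigenBasis {d : ℕ} (x : gl d) where
  vec : Module.Basis (Fin d) ℂ (Cd d)
  val : Fin d → ℂ
  apply_vec : ∀ i, Matrix.toEuclideanLin x (vec i) = val i • vec i

/-- Regular semisimple matrices: diagonalizable with pairwise distinct eigenvalues. -/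
def IsRegularSemisimple {d : ℕ} (x : gl d) : Prop :=
  ∃ e : EigenBasis x, Function.Injective e.val

theorem isRegularSemisimple_iff {d : ℕ} (x : gl d) :
    IsRegularSemisimple x ↔ x.charpoly.Separable := by
  have hch : (Matrix.toEuclideanLin x).charpoly = x.charpoly := by
    rw [Matrix.toEuclideanLin_eq_toLin_orthonormal, Matrix.charpoly_toLin]
  constructor
  · rintro ⟨e, he⟩
    have : Matrix.toEuclideanLin x = Matrix.toLin e.vec e.vec (Matrix.diagonal e.val) := by
      refine e.vec.ext fun i => ?_
      simp [e.apply_vec, Matrix.toLin_self, Matrix.diagonal_apply]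
    rw [← hch, this, Matrix.charpoly_toLin, Matrix.charpoly_diagonal]
    exact Polynomial.separable_prod_X_sub_C_iff.2 he
  · intro h
    have hn : x.charpoly.roots.Nodup := Polynomial.nodup_roots h
    have hc : x.charpoly.roots.toFinset.card = d := by
      rw [Multiset.toFinset_card_of_nodup hn, IsAlgClosed.card_roots_eq_natDegree,
        Matrix.charpoly_natDegree_eq_dim, Fintype.card_fin]
    let l : Fin d → ℂ := fun i => (x.charpoly.roots.toFinset.equivFinOfCardEq hc).symm i
    have hl : Function.Injective l := Subtype.val_injective.comp (Equiv.injective _)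
    have hev : ∀ i, Module.End.HasEigenvalue (Matrix.toEuclideanLin x) (l i) := by
      intro i
      rw [Module.End.hasEigenvalue_iff_isRoot_charpoly, hch]
      exact Polynomial.isRoot_of_mem_roots
        (Multiset.mem_toFinset.1 ((x.charpoly.roots.toFinset.equivFinOfCardEq hc).symm i).2)
    choose v hv using fun i => (hev i).exists_hasEigenvector
    have hli := Module.End.eigenvectors_linearIndependent' _ l hl v hv
    refine ⟨⟨basisOfLinearIndependentOfCardEqFinrank' v hli (by simp), l, fun i => ?_⟩, hl⟩
    simpa using (hv i).apply_eq_smul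

theorem isOpen_regularSemisimple (d : ℕ) : IsOpen {x : gl d | IsRegularSemisimple x} := by
  have hcoef : ∀ k : ℕ, Continuous fun x : gl d => x.charpoly.coeff k := by
    intro k
    have : (fun x : gl d => x.charpoly.coeff k) = fun x : gl d =>
        MvPolynomial.eval (fun p : Fin d × Fin d => x p.1 p.2)
          ((Matrix.charpoly.univ ℂ (Fin d)).coeff k) := by
      funext x
      have := Matrix.charpoly.univ_coeff_eval₂Hom (n := Fin d) (RingHom.id ℂ) (fun p => x p.1 p.2) k
      exact this.symm
    rw [this]
    refine (MvPolynomial.continuous_eval _).comp ?_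
    fun_prop
  have hiff : ∀ x : gl d, IsRegularSemisimple x ↔
      Polynomial.resultant x.charpoly (Polynomial.derivative x.charpoly) d (d - 1) ≠ 0 := by
    intro x
    have h1 : x.charpoly.natDegree = d := by simp [Matrix.charpoly_natDegree_eq_dim]
    have h2 : (Polynomial.derivative x.charpoly).natDegree = d - 1 := by
      rw [Polynomial.natDegree_derivative, h1]
    have := Polynomial.isUnit_resultant_iff_isCoprime (g := Polynomial.derivative x.charpoly)
      (Matrix.charpoly_monic x)
    rw [h1, h2, isUnit_iff_ne_zero] at this
    rw [isRegularSemisimple_iff, this]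
    rfl
  simp only [hiff]
  refine isOpen_ne_fun ?_ continuous_const
  unfold Polynomial.resultant
  refine Continuous.matrix_det ?_
  refine continuous_matrix fun i j => ?_
  unfold Polynomial.sylvester
  simp only [Matrix.of_apply]
  induction j using Fin.addCases <;> simp only [Fin.addCases_left, Fin.addCases_right] <;>
    split_ifs <;> first | exact continuous_const | skip
  all_goals first | exact hcoef _ | (simp only [Polynomial.coeff_derivative]; exact (hcoef _).mul continuous_const)

/-- The open subset of regular semisimple elements of `gl_d`. -/
def glrs (d : ℕ) : Opens (gl d) := ⟨{x | IsRegularSemisimple x}, isOpen_regularSemisimple d⟩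

instance (d : ℕ) : LocallyConnectedSpace (glrs d) :=
  haveI : LocallyConnectedSpace (gl d) := inferInstanceAs (LocallyConnectedSpace (Fin d → Fin d → ℂ))
  (glrs d).isOpen.locallyConnectedSpace

/-- An `n`-step partial flag `0 = F_0 ⊆ F_1 ⊆ ⋯ ⊆ F_n = ℂ^d`, inclusions not necessarily proper. -/
@[ext]
structure PartialFlag (n d : ℕ) where
  space : Fin (n + 1) → Submodule ℂ (Cd d)
  mono : Monotone space
  zero_eq : space 0 = ⊥
  last_eq : space (Fin.last n) = ⊤

/-- The usual topology on the space of flags: a subspace is identified with the orthogonal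
projection onto it, so flags form a subspace of a product of spaces of endomorphisms. -/
instance (n d : ℕ) : TopologicalSpace (PartialFlag n d) :=
  TopologicalSpace.induced (fun F j => (F.space j).starProjection) inferInstance

/-- Pairs `(x, F)` of a matrix and an `n`-step flag with `x F_j ⊆ F_j` for all `j`. -/
abbrev Mperp (n d : ℕ) : Type :=
  {p : gl d × PartialFlag n d // ∀ j, ∀ v ∈ p.2.space j, Matrix.toEuclideanLin p.1 v ∈ p.2.space j}

/-- The projection `(x, F) ↦ x`. -/
def muTilde (n d : ℕ) : TopCat.of (Mperp n d) ⟶ TopCat.of (gl d) :=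
  TopCat.ofHom ⟨fun p => p.1.1, by fun_prop⟩

/-- The direct image of the constant sheaf `ℂ` under `muTilde`. -/
def muTildePushforward (n d : ℕ) : (TopCat.of (gl d)).Sheaf (ModuleCat.{0} ℂ) :=
  (TopCat.Sheaf.pushforward _ (muTilde n d)).obj (constSheaf _ (ModuleCat.of ℂ ℂ))

/-- The restriction of the direct image of the constant sheaf to the regular semisimple locus. -/
def muTildeSheafRS (n d : ℕ) : (TopCat.of (glrs d)).Sheaf (ModuleCat.{0} ℂ) :=
  (Opens.sheafRestrict (X := TopCat.of (gl d)) (glrs d)).obj (muTildePushforward n d)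

/-- The flag attached to `φ : {1,…,d} → {1,…,n}`: `F_j` is spanned by the basis vectors `b_i` with
`φ i ≤ j`. The values of `φ` are numbered from `0` here, whence the strict inequality. -/
def flagOfMap {n d : ℕ} (b : Module.Basis (Fin d) ℂ (Cd d)) (φ : Fin d → Fin n) :
    PartialFlag n d where
  space j := Submodule.span ℂ (b '' {i | (φ i).castSucc < j})
  mono j k hjk := Submodule.span_mono (Set.image_mono fun i hi => lt_of_lt_of_le hi hjk)
  zero_eq := by simp
  last_eq := by simp [Fin.castSucc_lt_last]

/-- `φ i` is the minimal index `j` with `b_i ∈ F_j` (up to the shift of the numbering). -/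
theorem mem_flagOfMap_iff {n d : ℕ} (b : Module.Basis (Fin d) ℂ (Cd d)) (φ : Fin d → Fin n)
    (i : Fin d) (j : Fin (n + 1)) :
    b i ∈ (flagOfMap b φ).space j ↔ (φ i).castSucc < j := by
  change b i ∈ Submodule.span ℂ (b '' {i | (φ i).castSucc < j}) ↔ _
  rw [Module.Basis.mem_span_image]
  simp

/-- The point of the fibre of `muTilde` over `x` attached to `φ`. -/
def EigenBasis.fiberPoint {n d : ℕ} {x : gl d} (e : EigenBasis x) (φ : Fin d → Fin n) :
    Mperp n d :=
  ⟨(x, flagOfMap e.vec φ), fun j => by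
    change (flagOfMap e.vec φ).space j ≤
      Submodule.comap (Matrix.toEuclideanLin x) ((flagOfMap e.vec φ).space j)
    refine Submodule.span_le.2 ?_
    rintro _ ⟨i, hi, rfl⟩
    change Matrix.toEuclideanLin x (e.vec i) ∈ (flagOfMap e.vec φ).space j
    rw [e.apply_vec]
    exact Submodule.smul_mem _ _ (Submodule.subset_span ⟨i, hi, rfl⟩)⟩
/-- The natural representation of `S_d` on the `d`-th tensor power of `ℂ^n`:
`σ (v_1 ⊗ ⋯ ⊗ v_d) = v_{σ⁻¹ 1} ⊗ ⋯ ⊗ v_{σ⁻¹ d}`. -/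
def tensorPerm (n d : ℕ) :
    Representation ℂ (Equiv.Perm (Fin d)) (⨂[ℂ] _ : Fin d, (Fin n → ℂ)) where
  toFun σ := (PiTensorProduct.reindex ℂ (fun _ => Fin n → ℂ) σ).toLinearMap
  map_one' := LinearMap.ext fun v => LinearEquiv.congr_fun (PiTensorProduct.reindex_refl) v
  map_mul' σ τ := LinearMap.ext fun v =>
    (LinearEquiv.congr_fun (PiTensorProduct.reindex_trans (s := fun _ => Fin n → ℂ) τ σ) v).symm

/-- A section over `U` of the direct image is a locally constant function on the preimage of `U`;
this is its value at a point of the fibre over `x ∈ U`. -/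
def evalAt {n d : ℕ} {U : Opens (TopCat.of (glrs d))} (s : (muTildeSheafRS n d).presheaf.obj (op U))
    (x : glrs d) (hx : x ∈ U) (F : Mperp n d) (hF : F.1.1 = x.1) : ℂ :=
  (show LocallyConstant _ ℂ from s) ⟨F, ⟨x, hx, hF.symm⟩⟩

end FlagMonodromy

end

open FlagMonodromy

/-!
A regular semisimple matrix has exactly `d` eigenvalues, and they vary continuously with the
matrix, so the pairs `(x, eigenvalue of x)` form a `d`-sheeted covering of `glrs d`. Its monodromy
is `ρ`. A flag stable under `x` is a sum of eigenlines in each step, hence is `F^φ` for a unique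
`φ`; the projection onto each of its steps is a polynomial in `x` with coefficients depending
continuously on the eigenvalues. Therefore, wherever the eigenvalues can be numbered continuously,
`muTilde` is a trivial covering with fibre the set of all `φ`: this trivializes the direct image,
identifies germs with functions of `φ`, and shows that continuing a germ along a loop permutes the
`φ` as the loop permutes the eigenvalues. Every permutation arises: writing `x = P D P⁻¹` in two
ways, with the eigenvalues in different orders, one joins both the invertible matrices `P` and the
diagonals with distinct entries, since complements of complex hypersurfaces are path connected.
-/

noncomputable section

namespace FlagMonodromy

open Polynomial Topology

/-! ### Eigenbases -/

theorem hasEigenvalue_toEuclideanLin_iff {ι 𝕜 : Type*} [Fintype ι] [DecidableEq ι] [RCLike 𝕜]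
    (x : Matrix ι ι 𝕜) (z : 𝕜) :
    Module.End.HasEigenvalue (Matrix.toEuclideanLin x) z ↔ x.charpoly.IsRoot z := by
  rw [Module.End.hasEigenvalue_iff_isRoot_charpoly, Matrix.toEuclideanLin_eq_toLin_orthonormal,
    Matrix.charpoly_toLin]

namespace EigenBasis

variable {n d : ℕ} {x : gl d}

theorem toEuclideanLin_eq_toLin_diagonal (e : EigenBasis x) :
    Matrix.toEuclideanLin x = Matrix.toLin e.vec e.vec (Matrix.diagonal e.val) :=
  e.vec.ext fun i => by simp [e.apply_vec, Matrix.toLin_self, Matrix.diagonal_apply]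

theorem charpoly_eq (e : EigenBasis x) : x.charpoly = ∏ i, (X - C (e.val i)) := by
  rw [← Matrix.charpoly_diagonal, ← Matrix.charpoly_toLin (Matrix.diagonal e.val) e.vec,
    ← e.toEuclideanLin_eq_toLin_diagonal, Matrix.toEuclideanLin_eq_toLin_orthonormal,
    Matrix.charpoly_toLin]

theorem val_injective (e : EigenBasis x) (hx : IsRegularSemisimple x) :
    Function.Injective e.val := by
  rw [isRegularSemisimple_iff, e.charpoly_eq] at hx
  exact separable_prod_X_sub_C_iff.1 hx

theorem hasEigenvector (e : EigenBasis x) (i : Fin d) :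
    Module.End.HasEigenvector (Matrix.toEuclideanLin x) (e.val i) (e.vec i) :=
  ⟨Module.End.mem_eigenspace_iff.2 (e.apply_vec i), e.vec.ne_zero i⟩

theorem hasEigenvalue_iff (e : EigenBasis x) {z : ℂ} :
    Module.End.HasEigenvalue (Matrix.toEuclideanLin x) z ↔ ∃ i, e.val i = z := by
  rw [hasEigenvalue_toEuclideanLin_iff, e.charpoly_eq, IsRoot, eval_prod,
    Finset.prod_eq_zero_iff]
  simp [sub_eq_zero, eq_comm (a := z)]

theorem exists_val_eq {l : Fin d → ℂ} (hl : Function.Injective l)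
    (hev : ∀ i, Module.End.HasEigenvalue (Matrix.toEuclideanLin x) (l i)) :
    ∃ e : EigenBasis x, e.val = l := by
  choose v hv using fun i => (hev i).exists_hasEigenvector
  have hli := Module.End.eigenvectors_linearIndependent' _ l hl v hv
  refine ⟨⟨basisOfLinearIndependentOfCardEqFinrank' v hli (by simp), l, fun i => ?_⟩, rfl⟩
  simpa using (hv i).apply_eq_smul

/-- The eigenbasis renumbered along `σ`: its `i`-th member is the `σ i`-th member of `e`. -/
def reindex (e : EigenBasis x) (σ : Equiv.Perm (Fin d)) : EigenBasis x where
  vec := e.vec.reindex σ.symm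
  val := e.val ∘ σ
  apply_vec i := by simp [e.apply_vec]

theorem flagOfMap_reindex (e : EigenBasis x) (σ : Equiv.Perm (Fin d)) (φ : Fin d → Fin n) :
    flagOfMap (e.reindex σ).vec φ = flagOfMap e.vec (φ ∘ σ.symm) := by
  ext1
  funext j
  refine congrArg (Submodule.span ℂ) ?_
  have hvec : ⇑(e.reindex σ).vec = e.vec ∘ σ := by
    ext1 i
    simp [reindex]
  rw [hvec, Set.image_comp, σ.image_eq_preimage_symm]
  rfl

theorem fiberPoint_reindex (e : EigenBasis x) (σ : Equiv.Perm (Fin d)) (φ : Fin d → Fin n) :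
    (e.reindex σ).fiberPoint φ = e.fiberPoint (φ ∘ σ.symm) :=
  Subtype.ext (congrArg (Prod.mk x) (e.flagOfMap_reindex σ φ))

end EigenBasis

/-! ### Spectral projectors -/

/-- The polynomial taking the value `1` at the nodes `l i`, `i ∈ S`, and `0` at the others. -/
def indicatorPoly {ι K : Type*} [Fintype ι] [DecidableEq ι] [Field K] (l : ι → K) (S : Finset ι) :
    K[X] :=
  Lagrange.interpolate Finset.univ l fun i => if i ∈ S then 1 else 0

theorem eval_indicatorPoly {ι K : Type*} [Fintype ι] [DecidableEq ι] [Field K] {l : ι → K}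
    (hl : Function.Injective l) (S : Finset ι) (i : ι) :
    (indicatorPoly l S).eval (l i) = if i ∈ S then 1 else 0 :=
  Lagrange.eval_interpolate_at_node _ hl.injOn (Finset.mem_univ i)

theorem continuous_aeval_indicatorPoly {ι K A T : Type*} [Fintype ι] [DecidableEq ι] [Field K]
    [TopologicalSpace K] [IsTopologicalDivisionRing K] [Ring A] [TopologicalSpace A]
    [IsTopologicalRing A] [Algebra K A] [ContinuousSMul K A] [TopologicalSpace T]
    {l : T → ι → K} {a : T → A} (hl : Continuous l) (hinj : ∀ t, Function.Injective (l t))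
    (ha : Continuous a) (S : Finset ι) :
    Continuous fun t => aeval (a t) (indicatorPoly (l t) S) := by
  have hl' : ∀ i, Continuous fun t => l t i := fun i => (continuous_apply i).comp hl
  have hdiv : ∀ i j, i ≠ j →
      Continuous fun t => aeval (a t) (Lagrange.basisDivisor (l t i) (l t j)) := by
    intro i j hij
    simp only [Lagrange.basisDivisor, map_mul, aeval_C, map_sub, aeval_X,
      Algebra.algebraMap_eq_smul_one]
    have hinv : Continuous fun t => (l t i - l t j)⁻¹ :=
      ((hl' i).sub (hl' j)).inv₀ fun t => sub_ne_zero.2 ((hinj t).ne hij)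
    exact (hinv.smul continuous_const).mul (ha.sub ((hl' j).smul continuous_const))
  have hprod : ∀ (i : ι) (s : Finset ι), i ∉ s → Continuous fun t =>
      aeval (a t) (∏ j ∈ s, Lagrange.basisDivisor (l t i) (l t j)) := by
    intro i s hs
    induction s using Finset.induction_on with
    | empty => simpa using continuous_const
    | insert j s hj ih =>
      rw [Finset.mem_insert, not_or] at hs
      simp only [Finset.prod_insert hj, map_mul]
      exact (hdiv i j hs.1).mul (ih hs.2)
  simp only [indicatorPoly, Lagrange.interpolate_apply, map_sum, map_mul, aeval_C]
  exact continuous_finsetSum _ fun i _ =>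
    continuous_const.mul (hprod i _ (Finset.notMem_erase i _))

/-- The spectral projector of `x` onto the sum of the eigenspaces for the `l i`, `i ∈ S`, when `l`
numbers the eigenvalues of `x`. -/
def spectralProj {d : ℕ} (x : gl d) (l : Fin d → ℂ) (S : Finset (Fin d)) : Cd d →L[ℂ] Cd d :=
  aeval (Matrix.toEuclideanCLM (𝕜 := ℂ) x) (indicatorPoly l S)

section SpectralProj

variable {d : ℕ} {x : gl d}

theorem spectralProj_apply (x : gl d) (l : Fin d → ℂ) (S : Finset (Fin d)) (v : Cd d) :
    spectralProj x l S v = aeval (Matrix.toEuclideanLin x) (indicatorPoly l S) v :=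
  LinearMap.congr_fun (hom_eval₂ (indicatorPoly l S) (algebraMap ℂ (Cd d →L[ℂ] Cd d))
    ContinuousLinearMap.toLinearMapRingHom (Matrix.toEuclideanCLM (𝕜 := ℂ) x)) v

theorem spectralProj_mem_of_stable {W : Submodule ℂ (Cd d)}
    (hW : ∀ v ∈ W, Matrix.toEuclideanLin x v ∈ W) (l : Fin d → ℂ) (S : Finset (Fin d)) {v : Cd d}
    (hv : v ∈ W) : spectralProj x l S v ∈ W := by
  rw [spectralProj_apply]
  exact aeval_apply_smul_mem_of_le_comap hv _ _ hW

theorem spectralProj_vec (e : EigenBasis x) (he : Function.Injective e.val)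
    (S : Finset (Fin d)) (i : Fin d) :
    spectralProj x e.val S (e.vec i) = if i ∈ S then e.vec i else 0 := by
  rw [spectralProj_apply, Module.End.aeval_apply_of_hasEigenvector (e.hasEigenvector i),
    eval_indicatorPoly he, ite_smul, one_smul, zero_smul]

theorem spectralProj_eq_sum (e : EigenBasis x) (he : Function.Injective e.val)
    (S : Finset (Fin d)) (v : Cd d) :
    spectralProj x e.val S v = ∑ i ∈ S, e.vec.repr v i • e.vec i := by
  conv_lhs => rw [← e.vec.sum_repr v, map_sum]
  simp [spectralProj_vec e he, Finset.sum_ite_mem]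

theorem isProj_spectralProj (e : EigenBasis x) (he : Function.Injective e.val)
    (S : Finset (Fin d)) :
    LinearMap.IsProj (Submodule.span ℂ (e.vec '' S)) (spectralProj x e.val S) where
  map_mem v := by
    rw [spectralProj_eq_sum e he]
    exact Submodule.sum_mem _ fun i hi =>
      Submodule.smul_mem _ _ (Submodule.subset_span ⟨i, hi, rfl⟩)
  map_id v hv := by
    refine LinearMap.eqOn_span (f := (spectralProj x e.val S : Cd d →ₗ[ℂ] Cd d))
      (g := LinearMap.id) ?_ hv
    rintro _ ⟨i, hi, rfl⟩
    exact (spectralProj_vec e he S i).trans (if_pos hi)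

theorem eq_span_of_stable (e : EigenBasis x) (he : Function.Injective e.val)
    {W : Submodule ℂ (Cd d)} (hW : ∀ v ∈ W, Matrix.toEuclideanLin x v ∈ W) :
    W = Submodule.span ℂ (e.vec '' {i | e.vec i ∈ W}) := by
  refine le_antisymm (fun v hv => ?_) (Submodule.span_le.2 (Set.image_subset_iff.2 fun i hi => hi))
  rw [← e.vec.sum_repr v]
  refine Submodule.sum_mem _ fun i _ => ?_
  have hi : e.vec.repr v i • e.vec i ∈ W := by
    simpa [spectralProj_eq_sum e he] using spectralProj_mem_of_stable hW e.val {i} hv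
  rcases eq_or_ne (e.vec.repr v i) 0 with h0 | h0
  · simp [h0]
  · exact Submodule.smul_mem _ _
      (Submodule.subset_span ⟨i, (Submodule.smul_mem_iff W h0).1 hi, rfl⟩)

theorem continuous_spectralProj {T : Type*} [TopologicalSpace T] {x : T → gl d}
    {l : T → Fin d → ℂ} (hx : Continuous x) (hl : Continuous l)
    (hinj : ∀ t, Function.Injective (l t)) (S : Finset (Fin d)) :
    Continuous fun t => spectralProj (x t) (l t) S := by
  have hlin : Continuous (Matrix.toEuclideanCLM (𝕜 := ℂ) (n := Fin d)).toAlgEquiv.toLinearMap :=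
    LinearMap.continuous_of_finiteDimensional _
  exact continuous_aeval_indicatorPoly hl hinj (hlin.comp hx) S

end SpectralProj

/-! ### Orthogonal projections onto ranges of idempotents -/

theorem isUnit_add_star_sub_one {A : Type*} [CStarAlgebra A] {q : A} (hq : IsIdempotentElem q) :
    IsUnit (q + star q - 1) := by
  let _ := CStarAlgebra.spectralOrder A
  have _ := CStarAlgebra.spectralOrderedRing A
  have hsq : (q + star q - 1) ^ 2 = 1 + star (q - star q) * (q - star q) := by
    simp only [pow_two, star_sub, star_star, mul_sub, sub_mul, mul_add, add_mul, mul_one, one_mul,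
      hq.eq, hq.star.eq]
    abel
  have hone : (1 : A) ≤ (q + star q - 1) ^ 2 :=
    hsq ▸ le_add_of_nonneg_right (star_mul_self_nonneg _)
  exact (isUnit_pow_iff two_ne_zero).1 (CStarAlgebra.isUnit_of_le 1 hone)

section IsProj

variable {E : Type*} [NormedAddCommGroup E] [InnerProductSpace ℂ E] [CompleteSpace E]

theorem starProjection_eq_mul_inverse {Q : E →L[ℂ] E} {W : Submodule ℂ E}
    [W.HasOrthogonalProjection] (hQ : LinearMap.IsProj W Q) :
    W.starProjection = Q * Ring.inverse (Q + star Q - 1) := by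
  have hidem : IsIdempotentElem Q :=
    ContinuousLinearMap.ext fun v => hQ.map_id _ (hQ.map_mem v)
  have hQP : Q * W.starProjection = W.starProjection :=
    ContinuousLinearMap.ext fun v => hQ.map_id _ (W.starProjection_apply_mem v)
  have hPQ : W.starProjection * Q = Q :=
    ContinuousLinearMap.ext fun v => Submodule.starProjection_eq_self_iff.2 (hQ.map_mem v)
  have hPQ' : W.starProjection * star Q = W.starProjection := by
    simpa only [star_mul, (isSelfAdjoint_starProjection W).star_eq] using congrArg star hQP
  have hP : W.starProjection * (Q + star Q - 1) = Q := by
    rw [mul_sub, mul_add, hPQ, hPQ', mul_one, add_sub_cancel_right]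
  nth_rewrite 1 [← hP]
  rw [mul_assoc, Ring.mul_inverse_cancel _ (isUnit_add_star_sub_one hidem), mul_one]

theorem continuous_starProjection {T : Type*} [TopologicalSpace T] {Q : T → E →L[ℂ] E}
    {W : T → Submodule ℂ E} [∀ t, (W t).HasOrthogonalProjection] (hc : Continuous Q)
    (hQ : ∀ t, LinearMap.IsProj (W t) (Q t)) : Continuous fun t => (W t).starProjection := by
  simp only [fun t => starProjection_eq_mul_inverse (hQ t)]
  refine hc.mul (continuous_iff_continuousAt.2 fun t => ?_)
  have hidem : IsIdempotentElem (Q t) :=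
    ContinuousLinearMap.ext fun v => (hQ t).map_id _ ((hQ t).map_mem v)
  obtain ⟨u, hu⟩ := isUnit_add_star_sub_one hidem
  have hsum : Continuous fun t => Q t + star (Q t) - 1 :=
    (hc.add (continuous_star.comp hc)).sub continuous_const
  exact ContinuousAt.comp (f := fun t => Q t + star (Q t) - 1)
    (hu ▸ NormedRing.inverse_continuousAt u) hsum.continuousAt

end IsProj

/-! ### Flags attached to eigenbases -/

section Flags

variable {n d : ℕ}

theorem isProj_flagOfMap_space {x : gl d} (e : EigenBasis x) (he : Function.Injective e.val)
    (φ : Fin d → Fin n) (j : Fin (n + 1)) :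
    LinearMap.IsProj ((flagOfMap e.vec φ).space j)
      (spectralProj x e.val {i | (φ i).castSucc < j}) := by
  have h := isProj_spectralProj e he {i | (φ i).castSucc < j}
  rwa [Finset.coe_filter_univ] at h

theorem fiberPoint_eq_of_val_eq {x : gl d} {e e' : EigenBasis x} (he : Function.Injective e.val)
    (h : e'.val = e.val) (φ : Fin d → Fin n) : e'.fiberPoint φ = e.fiberPoint φ := by
  refine Subtype.ext (congrArg (Prod.mk x) (PartialFlag.ext (funext fun j => ?_)))
  have hp := isProj_flagOfMap_space e he φ j
  have hp' := isProj_flagOfMap_space e' (h ▸ he) φ j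
  rw [h] at hp'
  exact le_antisymm (fun v hv => hp'.map_id v hv ▸ hp.map_mem v)
    fun v hv => hp.map_id v hv ▸ hp'.map_mem v

theorem continuous_fiberPoint {T : Type*} [TopologicalSpace T] {x : T → gl d} (hx : Continuous x)
    (e : ∀ t, EigenBasis (x t)) (he : ∀ t, Function.Injective (e t).val)
    (hc : Continuous fun t => (e t).val) (φ : Fin d → Fin n) :
    Continuous fun t => (e t).fiberPoint φ := by
  refine Continuous.subtype_mk (hx.prodMk (continuous_induced_rng.2 (continuous_pi fun j => ?_))) _
  exact continuous_starProjection (continuous_spectralProj hx hc he _)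
    fun t => isProj_flagOfMap_space (e t) (he t) φ j

instance : T2Space (PartialFlag n d) :=
  T2Space.of_injective_continuous
    (fun _ _ h => PartialFlag.ext (funext fun j => Submodule.starProjection_inj.1 (congrFun h j)))
    continuous_induced_dom

theorem exists_forall_mem_space_iff (F : PartialFlag n d) {v : Cd d} (hv : v ≠ 0) :
    ∃ k : Fin n, ∀ j, v ∈ F.space j ↔ k.castSucc < j := by
  have hlast : v ∈ F.space (Fin.last n) := F.last_eq ▸ Submodule.mem_top
  obtain ⟨m, hm, hmin⟩ := (Set.toFinite {j | v ∈ F.space j}).exists_minimal ⟨_, hlast⟩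
  have hm0 : m ≠ 0 := by
    rintro rfl
    rw [Set.mem_ofPred_eq, F.zero_eq, Submodule.mem_bot] at hm
    exact hv hm
  obtain ⟨k, rfl⟩ := Fin.exists_succ_eq.2 hm0
  refine ⟨k, fun j => ?_⟩
  rw [Fin.castSucc_lt_iff_succ_le]
  exact ⟨fun hj => (le_total k.succ j).elim id (hmin hj), fun hj => F.mono hj hm⟩

theorem exists_fiberPoint_eq {x : gl d} (e : EigenBasis x) (he : Function.Injective e.val)
    (F : Mperp n d) (hF : F.1.1 = x) : ∃ φ : Fin d → Fin n, e.fiberPoint φ = F := by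
  obtain ⟨⟨y, F⟩, hst⟩ := F
  obtain rfl : y = x := hF
  choose φ hφ using fun i => exists_forall_mem_space_iff F (e.vec.ne_zero i)
  refine ⟨φ, Subtype.ext (congrArg (Prod.mk y) (PartialFlag.ext (funext fun j => ?_)))⟩
  change Submodule.span ℂ (e.vec '' {i | (φ i).castSucc < j}) = F.space j
  rw [eq_span_of_stable e he (hst j)]
  simp only [hφ]

theorem fiberPoint_injective {x : gl d} (e : EigenBasis x) :
    Function.Injective (e.fiberPoint : (Fin d → Fin n) → Mperp n d) := by
  intro φ ψ h
  have hflag : flagOfMap e.vec φ = flagOfMap e.vec ψ := congrArg (fun p : Mperp n d => p.1.2) h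
  funext i
  have hlt : ∀ j : Fin (n + 1), (φ i).castSucc < j ↔ (ψ i).castSucc < j := fun j => by
    rw [← mem_flagOfMap_iff e.vec φ, ← mem_flagOfMap_iff e.vec ψ, hflag]
  exact le_antisymm (Fin.castSucc_lt_succ_iff.1 ((hlt (ψ i).succ).2 Fin.castSucc_lt_succ))
    (Fin.castSucc_lt_succ_iff.1 ((hlt (φ i).succ).1 Fin.castSucc_lt_succ))

end Flags

/-! ### Finite families of sections -/

section FiniteSections

variable {Z B ι : Type*} [TopologicalSpace Z] [TopologicalSpace B] [T2Space Z] [Finite ι]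
  [TopologicalSpace ι] [DiscreteTopology ι]

theorem isHomeomorph_of_sections {q : Z → B} (hq : Continuous q) {s : ι → B → Z}
    (hs : ∀ i, Continuous (s i)) (hqs : ∀ i, Function.LeftInverse q (s i))
    (hinj : ∀ b, Function.Injective fun i => s i b) (hsurj : ∀ z, ∃ i, s i (q z) = z) :
    IsHomeomorph fun p : B × ι => s p.2 p.1 := by
  refine isHomeomorph_iff_continuous_isClosedMap_bijective.2
    ⟨continuous_prod_of_discrete_right.2 hs, fun K hK => ?_, ?_, fun z => ?_⟩
  · have himage : (fun p : B × ι => s p.2 p.1) '' K = ⋃ i, s i '' {b | (b, i) ∈ K} := by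
      ext z
      simp [Prod.exists, exists_comm (α := B)]
    rw [himage]
    exact isClosed_iUnion_of_finite fun i => ((hqs i).isClosedEmbedding hq (hs i)).isClosedMap _
      (hK.preimage (Continuous.prodMk_left i))
  · rintro ⟨b, i⟩ ⟨b', i'⟩ h
    obtain rfl : b = b' := by simpa only [hqs _ _] using congrArg q h
    exact congrArg _ (hinj b h)
  · obtain ⟨i, hi⟩ := hsurj z
    exact ⟨(q z, i), hi⟩

theorem isEvenlyCovered_of_sections {p : Z → B} (hp : Continuous p) {U : Set B} (hU : IsOpen U)
    {x : B} (hx : x ∈ U) {s : ι → U → Z} (hs : ∀ i, Continuous (s i)) (hps : ∀ i y, p (s i y) = y)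
    (hinj : ∀ y, Function.Injective fun i => s i y)
    (hsurj : ∀ z (h : p z ∈ U), ∃ i, s i ⟨p z, h⟩ = z) : IsEvenlyCovered p x ι := by
  have hsU : ∀ i y, s i y ∈ p ⁻¹' U := fun i y => by
    rw [Set.mem_preimage, hps]
    exact y.2
  have hhomeo := isHomeomorph_of_sections (q := U.restrictPreimage p) hp.restrictPreimage
    (s := fun i y => ⟨s i y, hsU i y⟩) (fun i => (hs i).subtype_mk _)
    (fun i y => Subtype.ext (hps i y)) (fun y i j h => hinj y (congrArg Subtype.val h))
    fun z => (hsurj z.1 z.2).imp fun i hi => Subtype.ext hi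
  refine ⟨inferInstance, U, hx, hU, hU.preimage hp, hhomeo.homeomorph.symm, fun z => ?_⟩
  rw [← hps (hhomeo.homeomorph.symm z).2]
  exact congrArg (fun w : p ⁻¹' U => p w) (hhomeo.homeomorph.apply_symm_apply z)

end FiniteSections

/-! ### Local eigenvalue functions -/

theorem eventually_exists_hasEigenvalue_mem {ι : Type*} [Fintype ι] [DecidableEq ι]
    (x : Matrix ι ι ℂ) {z : ℂ} (hz : Module.End.HasEigenvalue (Matrix.toEuclideanLin x) z)
    {V : Set ℂ} (hV : V ∈ 𝓝 z) :
    ∀ᶠ y in 𝓝 x, ∃ w ∈ V, Module.End.HasEigenvalue (Matrix.toEuclideanLin y) w := by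
  simp only [hasEigenvalue_toEuclideanLin_iff] at hz ⊢
  obtain ⟨ε, hε, hball⟩ := Metric.mem_nhds_iff.1 hV
  have hc : Continuous fun y : Matrix ι ι ℂ => ‖y.charpoly.eval z‖ := by
    simp only [Matrix.eval_charpoly]
    exact ((continuous_const.sub continuous_id).matrix_det).norm
  have hx : ‖x.charpoly.eval z‖ < ε ^ Fintype.card ι := by
    rw [hz.eq_zero, norm_zero]
    positivity
  filter_upwards [hc.continuousAt.eventually_lt continuousAt_const hx] with y hy
  by_contra! hroot
  have hdist : ∀ w ∈ y.charpoly.roots, ε ≤ ‖z - w‖ := fun w hw => by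
    by_contra! hlt
    exact hroot w (hball (by rwa [Metric.mem_ball', dist_eq_norm])) (isRoot_of_mem_roots hw)
  refine hy.not_ge ?_
  calc ε ^ Fintype.card ι = (y.charpoly.roots.map fun _ => ε).prod := by
        rw [Multiset.map_const', Multiset.prod_replicate, IsAlgClosed.card_roots_eq_natDegree,
          Matrix.charpoly_natDegree_eq_dim]
    _ ≤ (y.charpoly.roots.map fun w => ‖z - w‖).prod :=
        Multiset.prod_map_le_prod_map₀ _ _ (fun _ _ => hε.le) hdist
    _ = ‖y.charpoly.eval z‖ := by
        rw [(IsAlgClosed.splits _).eval_eq_prod_roots_of_monic y.charpoly_monic]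
        exact (Multiset.prod_hom' _ (normHom (α := ℂ)) _)

section Eigenvalues

variable {d : ℕ}

theorem exists_continuous_eigenBasis_nhds (x : glrs d) (e : EigenBasis x.1) :
    ∃ (U : Opens (glrs d)) (hx : x ∈ U) (e' : ∀ y : U, EigenBasis y.1.1),
      (e' ⟨x, hx⟩).val = e.val ∧ Continuous fun y => (e' y).val := by
  obtain ⟨V, hV, hdisj⟩ := (Set.finite_range e.val).t2_separation
  have hsep : ∀ i j w, w ∈ V (e.val i) → w ∈ V (e.val j) → i = j := fun i j w hi hj =>
    e.val_injective x.2 (hdisj.elim_set ⟨i, rfl⟩ ⟨j, rfl⟩ w hi hj)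
  have hnhds : ∀ (y : glrs d) (i : Fin d) (z : ℂ), z ∈ V (e.val i) →
      Module.End.HasEigenvalue (Matrix.toEuclideanLin y.1) z → ∀ N ∈ 𝓝 z, ∀ᶠ y' : glrs d in 𝓝 y,
        ∃ w ∈ N ∩ V (e.val i), Module.End.HasEigenvalue (Matrix.toEuclideanLin y'.1) w :=
    fun y i z hzV hz N hN => continuous_subtype_val.continuousAt.eventually
      (eventually_exists_hasEigenvalue_mem y.1 hz (Filter.inter_mem hN ((hV _).2.mem_nhds hzV)))
  obtain ⟨U, hU, hUo, hxU⟩ := eventually_nhds_iff.1 <| Filter.eventually_all.2 fun i =>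
    hnhds x i (e.val i) (hV _).1 (e.hasEigenvalue_iff.2 ⟨i, rfl⟩) _ Filter.univ_mem
  choose l hlV hl using hU
  have hinj : ∀ y hy, Function.Injective (l y hy) := fun y hy i j hij =>
    hsep i j (l y hy i) (hlV y hy i).2 (hij ▸ (hlV y hy j).2)
  choose e' he' using fun y : U => EigenBasis.exists_val_eq (hinj y.1 y.2) (hl y.1 y.2)
  have hmem : ∀ y i, (e' y).val i ∈ V (e.val i) := fun y i => he' y ▸ (hlV y.1 y.2 i).2
  have huniq : ∀ (y : U) (w : ℂ) (i : Fin d), w ∈ V (e.val i) →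
      Module.End.HasEigenvalue (Matrix.toEuclideanLin y.1.1) w → (e' y).val i = w := by
    intro y w i hwV hw
    obtain ⟨j, rfl⟩ := (e' y).hasEigenvalue_iff.1 hw
    rw [hsep j i _ (hmem y j) hwV]
  refine ⟨⟨U, hUo⟩, hxU, e', funext fun i => ?_, continuous_pi fun i => ?_⟩
  · exact huniq _ _ i (hV _).1 (e.hasEigenvalue_iff.2 ⟨i, rfl⟩)
  · refine continuous_iff_continuousAt.2 fun y N hN => Filter.mem_map.2 ?_
    have hev := hnhds y.1 i _ (hmem y i) ((e' y).hasEigenvalue_iff.2 ⟨i, rfl⟩) N hN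
    filter_upwards [continuous_subtype_val.continuousAt.eventually hev]
    rintro y' ⟨w, ⟨hwN, hwV⟩, hw⟩
    rwa [Set.mem_preimage, huniq y' w i hwV hw]

/-! ### The covering by eigenvalues -/

/-- The space of pairs of a regular semisimple matrix and one of its eigenvalues. -/
abbrev EigenvalueCover (d : ℕ) : Type :=
  {p : glrs d × ℂ // Module.End.HasEigenvalue (Matrix.toEuclideanLin p.1.1) p.2}

/-- The covering map `(x, z) ↦ x`. -/
def EigenvalueCover.proj (p : EigenvalueCover d) : glrs d := p.1.1

theorem EigenvalueCover.isCoveringMap_proj :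
    IsCoveringMap (EigenvalueCover.proj : EigenvalueCover d → glrs d) := by
  intro x
  obtain ⟨e, -⟩ := x.2
  obtain ⟨U, hxU, e', -, hc⟩ := exists_continuous_eigenBasis_nhds x e
  refine (isEvenlyCovered_of_sections (ι := Fin d) (continuous_fst.comp continuous_subtype_val)
    U.isOpen hxU (s := fun i y => ⟨(y.1, (e' y).val i), (e' y).hasEigenvalue_iff.2 ⟨i, rfl⟩⟩)
    (fun i => ?_) (fun _ _ => rfl) (fun y i j h => ?_) ?_).to_isEvenlyCovered_preimage
  · exact (continuous_subtype_val.prodMk ((continuous_apply i).comp hc)).subtype_mk _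
  · exact (e' y).val_injective y.1.2 (congrArg (fun p : EigenvalueCover d => p.1.2) h)
  · rintro ⟨⟨y, w⟩, hw⟩ hy
    exact ((e' ⟨y, hy⟩).hasEigenvalue_iff.1 hw).imp fun i hi => Subtype.ext (Prod.ext rfl hi)

/-- The fibre of the covering by eigenvalues, numbered by an eigenbasis. -/
def EigenBasis.fiberEquiv {x : glrs d} (e : EigenBasis x.1) :
    Fin d ≃ (EigenvalueCover.proj : EigenvalueCover d → glrs d) ⁻¹' {x} :=
  Equiv.ofBijective (fun i => ⟨⟨(x, e.val i), e.hasEigenvalue_iff.2 ⟨i, rfl⟩⟩, rfl⟩) <| by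
    refine ⟨fun i j h => e.val_injective x.2 (congrArg (fun p => p.1.1.2) h), ?_⟩
    rintro ⟨⟨⟨y, w⟩, hw⟩, hy⟩
    obtain rfl : y = x := hy
    obtain ⟨i, rfl⟩ := e.hasEigenvalue_iff.1 hw
    exact ⟨i, rfl⟩

/-- The permutation of the eigenvalues of `x` along loops at `x`, i.e. the monodromy of the
covering by eigenvalues. -/
def EigenBasis.permHom {x : glrs d} (e : EigenBasis x.1) :
    FundamentalGroup (glrs d) x →* Equiv.Perm (Fin d) :=
  e.fiberEquiv.symm.permCongrHom.toMonoidHom.comp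
    (EigenvalueCover.isCoveringMap_proj.monodromyPerm x)

theorem eigenvalue_eq_of_eq_at {A : Type*} [TopologicalSpace A] [PreconnectedSpace A]
    {x : A → glrs d} (hx : Continuous x) {l l' : C(A, ℂ)}
    (hl : ∀ a, Module.End.HasEigenvalue (Matrix.toEuclideanLin (x a).1) (l a))
    (hl' : ∀ a, Module.End.HasEigenvalue (Matrix.toEuclideanLin (x a).1) (l' a)) {a : A}
    (ha : l a = l' a) : l = l' := by
  have h := EigenvalueCover.isCoveringMap_proj.eq_of_comp_eq
    (g₁ := fun a => (⟨(x a, l a), hl a⟩ : EigenvalueCover d)) (g₂ := fun a => ⟨(x a, l' a), hl' a⟩)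
    ((hx.prodMk l.continuous).subtype_mk _) ((hx.prodMk l'.continuous).subtype_mk _) rfl a
    (Subtype.ext (Prod.ext rfl ha))
  exact ContinuousMap.ext fun b => congrArg (fun p : EigenvalueCover d => p.1.2) (congrFun h b)

theorem exists_eigenvalue_lift {x y : glrs d} (γ : Path x y) {z : ℂ}
    (hz : Module.End.HasEigenvalue (Matrix.toEuclideanLin x.1) z) :
    ∃ l : C(unitInterval, ℂ), l 0 = z ∧
      ∀ t, Module.End.HasEigenvalue (Matrix.toEuclideanLin (γ t).1) (l t) := by
  obtain ⟨Γ, hΓ, hΓ0⟩ := EigenvalueCover.isCoveringMap_proj.exists_path_lifts γ.toContinuousMap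
    (⟨(x, z), hz⟩ : EigenvalueCover d) γ.source
  have hbase : ∀ t, (Γ t).1.1 = γ t := congrFun hΓ
  exact ⟨⟨fun t => (Γ t).1.2, by fun_prop⟩, congrArg (fun p : EigenvalueCover d => p.1.2) hΓ0,
    fun t => hbase t ▸ (Γ t).2⟩

theorem exists_continuous_eigenBasis_path {x y : glrs d} (γ : Path x y) (e : EigenBasis x.1) :
    ∃ e' : ∀ t, EigenBasis (γ t).1, (e' 0).val = e.val ∧ Continuous fun t => (e' t).val := by
  choose l hl0 hl using fun i => exists_eigenvalue_lift γ (e.hasEigenvalue_iff.2 ⟨i, rfl⟩)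
  have hinj : ∀ t, Function.Injective fun i => l i t := fun t i j hij => by
    have hlij : l i = l j := eigenvalue_eq_of_eq_at γ.continuous (hl i) (hl j) hij
    exact e.val_injective x.2 (by rw [← hl0, ← hl0, hlij])
  choose e' he' using fun t => EigenBasis.exists_val_eq (hinj t) fun i => hl i t
  refine ⟨e', (he' 0).trans (funext hl0), ?_⟩
  simp only [he']
  fun_prop

theorem EigenBasis.val_permHom {x : glrs d} (e : EigenBasis x.1) (γ : Path x x)
    (l : C(unitInterval, ℂ))
    (hl : ∀ t, Module.End.HasEigenvalue (Matrix.toEuclideanLin (γ t).1) (l t)) {i : Fin d}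
    (hi : l 0 = e.val i) :
    e.val (e.permHom (FundamentalGroup.fromPath (Path.Homotopic.Quotient.mk γ)) i) = l 1 := by
  have cov := EigenvalueCover.isCoveringMap_proj (d := d)
  let p₀ : EigenvalueCover d := ⟨(x, l 0), by simpa using hl 0⟩
  let p₁ : EigenvalueCover d := ⟨(x, l 1), by simpa using hl 1⟩
  let Γ : Path p₀ p₁ :=
    { toFun := fun t => ⟨(γ t, l t), hl t⟩
      source' := Subtype.ext (Prod.ext γ.source rfl)
      target' := Subtype.ext (Prod.ext γ.target rfl) }
  have hi' : e.fiberEquiv i = ⟨p₀, rfl⟩ := Subtype.ext (Subtype.ext (Prod.ext rfl hi.symm))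
  have hperm : e.fiberEquiv
      (e.permHom (FundamentalGroup.fromPath (Path.Homotopic.Quotient.mk γ)) i) = ⟨p₁, rfl⟩ := by
    change e.fiberEquiv (e.fiberEquiv.symm (cov.monodromy (Path.Homotopic.Quotient.mk γ)
      (e.fiberEquiv i))) = _
    rw [Equiv.apply_symm_apply, hi']
    exact cov.monodromy_map (Path.Homotopic.Quotient.mk Γ)
  exact congrArg (fun p => p.1.1.2) hperm

end Eigenvalues

/-! ### Sections of the direct image -/

/-- Currying of locally constant functions on the product with a finite discrete space. -/
def locallyConstantCurryₗ (R X ι M : Type*) [Semiring R] [TopologicalSpace X] [TopologicalSpace ι]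
    [DiscreteTopology ι] [Finite ι] [AddCommMonoid M] [Module R M] :
    LocallyConstant (X × ι) M ≃ₗ[R] LocallyConstant X (ι → M) where
  toFun f := LocallyConstant.unflip fun i => f.comap ⟨fun x => (x, i), by fun_prop⟩
  invFun g := ⟨fun p => g p.1 p.2, by
    let _ : TopologicalSpace M := ⊥
    have : DiscreteTopology M := ⟨rfl⟩
    exact (IsLocallyConstant.iff_continuous _).2
      (continuous_prod_of_discrete_right.2 fun i => (g.flip i).continuous)⟩
  left_inv _ := rfl
  right_inv _ := rfl
  map_add' _ _ := rfl
  map_smul' _ _ := rfl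

section Sections

variable {n d : ℕ}

theorem section_ext {U : Opens (TopCat.of (glrs d))}
    {s t : (muTildeSheafRS n d).presheaf.obj (op U)}
    (h : ∀ (x : glrs d) (hx : x ∈ U) (F : Mperp n d) (hF : F.1.1 = x.1),
      evalAt s x hx F hF = evalAt t x hx F hF) : s = t := by
  refine LocallyConstant.ext (Y := ℂ) ?_
  rintro ⟨F, y, hy, hF⟩
  exact h y hy F hF.symm

/-- The preimage under `muTilde` of an open set of regular semisimple matrices. -/
abbrev fiberDomain (n : ℕ) {d : ℕ} (U : Opens (glrs d)) : Type :=
  {F : Mperp n d // ∃ y : glrs d, y ∈ U ∧ y.1 = F.1.1}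

theorem isLocallyConstant_evalAt {U : Opens (TopCat.of (glrs d))}
    (s : (muTildeSheafRS n d).presheaf.obj (op U)) {T : Type*} [TopologicalSpace T]
    {p : T → Mperp n d} (hp : Continuous p) {y : T → glrs d} (hy : ∀ t, y t ∈ U)
    (h : ∀ t, (p t).1.1 = (y t).1) : IsLocallyConstant fun t => evalAt s (y t) (hy t) (p t) (h t) :=
  (LocallyConstant.isLocallyConstant
    (show LocallyConstant (fiberDomain n U) ℂ from s)).comp_continuous
      (f := fun t => ⟨p t, y t, hy t, (h t).symm⟩) (hp.subtype_mk _)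

variable {U : Opens (glrs d)}

/-- The base point of a point of `fiberDomain`. -/
def fiberDomain.base (F : fiberDomain n U) : U :=
  ⟨⟨F.1.1.1, F.2.elim fun y h => h.2 ▸ y.2⟩, by
    obtain ⟨F, y, hy, h⟩ := F
    exact (Subtype.ext h : y = ⟨F.1.1, h ▸ y.2⟩) ▸ hy⟩

theorem fiberDomain.continuous_base : Continuous (fiberDomain.base : fiberDomain n U → U) :=
  ((continuous_fst.comp (continuous_subtype_val.comp continuous_subtype_val)).subtype_mk
    _).subtype_mk _

/-- The trivialization of `muTilde` over an open set on which the eigenvalues are numbered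
continuously. -/
def fiberHomeomorph (n : ℕ) (e : ∀ y : U, EigenBasis y.1.1) (hc : Continuous fun y => (e y).val) :
    U × (Fin d → Fin n) ≃ₜ fiberDomain n U :=
  (isHomeomorph_of_sections fiberDomain.continuous_base
    (s := fun φ y => ⟨(e y).fiberPoint φ, y.1, y.2, rfl⟩)
    (fun φ => (continuous_fiberPoint (continuous_subtype_val.comp continuous_subtype_val) e
      (fun y => (e y).val_injective y.1.2) hc φ).subtype_mk _)
    (fun _ _ => rfl)
    (fun y _ _ h => fiberPoint_injective (e y) (congrArg Subtype.val h))
    fun F => (exists_fiberPoint_eq (e F.base) ((e F.base).val_injective F.base.1.2) F.1 rfl).imp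
      fun _ h => Subtype.ext h).homeomorph

/-- Sections over an open set on which the eigenvalues are numbered continuously, as locally
constant families of functions on the fibres. -/
def sectionEquiv (n : ℕ) (e : ∀ y : U, EigenBasis y.1.1) (hc : Continuous fun y => (e y).val) :
    (muTildeSheafRS n d).presheaf.obj (op (U : Opens (TopCat.of (glrs d))))
      ≃ₗ[ℂ] LocallyConstant U ((Fin d → Fin n) → ℂ) :=
  (LocallyConstant.congrLeftₗ ℂ (fiberHomeomorph n e hc).symm).trans
    (locallyConstantCurryₗ ℂ U (Fin d → Fin n) ℂ)

theorem sectionEquiv_apply (e : ∀ y : U, EigenBasis y.1.1) (hc : Continuous fun y => (e y).val)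
    (s : (muTildeSheafRS n d).presheaf.obj (op (U : Opens (TopCat.of (glrs d))))) (y : U)
    (φ : Fin d → Fin n) :
    sectionEquiv n e hc s y φ = evalAt s y.1 y.2 ((e y).fiberPoint φ) rfl := rfl

/-- An open subset of `U`, as an open set of regular semisimple matrices. -/
abbrev imageOpens (W : Opens U) : Opens (glrs d) :=
  (Opens.isOpenEmbedding (X := TopCat.of (glrs d)) U).isOpenMap.functor.obj W

theorem imageOpens_le (W : Opens U) : imageOpens W ≤ U := by
  rintro _ ⟨u, -, rfl⟩
  exact u.2

/-- The trivialization of the direct image over `U`, on the sections over an open subset of `U`. -/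
def restrictSectionEquiv (n : ℕ) (e : ∀ y : U, EigenBasis y.1.1)
    (hc : Continuous fun y => (e y).val) (W : Opens U) :
    (muTildeSheafRS n d).presheaf.obj (op (imageOpens W : Opens (TopCat.of (glrs d))))
      ≃ₗ[ℂ] LocallyConstant W ((Fin d → Fin n) → ℂ) :=
  (sectionEquiv n (fun y => e ⟨y.1, imageOpens_le W y.2⟩)
    (hc.comp (continuous_subtype_val.subtype_mk _))).trans
    (LocallyConstant.congrLeftₗ ℂ (IsEmbedding.subtypeVal.homeomorphImage (W : Set U)).symm)

theorem isLocalSystem_muTildeSheafRS (n d : ℕ) : IsLocalSystem (muTildeSheafRS n d) := by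
  intro x
  obtain ⟨e₀, -⟩ := (show glrs d from x).2
  obtain ⟨U, hxU, e, -, hc⟩ := exists_continuous_eigenBasis_nhds x e₀
  refine ⟨U, hxU, ModuleCat.of ℂ ((Fin d → Fin n) → ℂ),
    inferInstanceAs (Module.Finite ℂ ((Fin d → Fin n) → ℂ)),
    ⟨(fullyFaithfulSheafToPresheaf _ _).preimageIso (NatIso.ofComponents
      (fun W => (restrictSectionEquiv n e hc W.unop).toModuleIso) fun i => ?_)⟩⟩
  ext s
  rfl

/-! ### Stalks of the direct image -/

/-- Evaluation of sections at a point of the fibre over `x`, as a cocone over the diagram defining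
the stalk at `x`. -/
def evalCocone (x : TopCat.of (glrs d)) (F : Mperp n d) (hF : F.1.1 = x.1) :
    Limits.Cocone ((OpenNhds.inclusion x).op ⋙ (muTildeSheafRS n d).presheaf) where
  pt := ModuleCat.of ℂ ℂ
  ι :=
    { app := fun U => ModuleCat.ofHom
        { toFun := fun s => evalAt (U := U.unop.1) s x U.unop.2 F hF
          map_add' := fun _ _ => rfl
          map_smul' := fun _ _ => rfl }
      naturality := fun U V i => by
        ext s
        rfl }

/-- Evaluation of germs at a point of the fibre. -/
def evalStalk (x : TopCat.of (glrs d)) (F : Mperp n d) (hF : F.1.1 = x.1) :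
    (muTildeSheafRS n d).presheaf.stalk x →ₗ[ℂ] ℂ :=
  (Limits.colimit.desc _ (evalCocone x F hF)).hom

theorem evalStalk_germ (x : TopCat.of (glrs d)) (F : Mperp n d) (hF : F.1.1 = x.1)
    (U : Opens (TopCat.of (glrs d))) (hx : x ∈ U)
    (s : (muTildeSheafRS n d).presheaf.obj (op U)) :
    evalStalk x F hF ((muTildeSheafRS n d).presheaf.germ U x hx s) = evalAt s x hx F hF :=
  ConcreteCategory.congr_hom (Limits.colimit.ι_desc (evalCocone x F hF) (op ⟨U, hx⟩)) s

theorem eq_zero_of_evalStalk_fiberPoint_eq_zero {x : glrs d} (e : EigenBasis x.1)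
    {a : (muTildeSheafRS n d).presheaf.stalk x}
    (ha : ∀ φ, evalStalk (x : TopCat.of (glrs d)) (e.fiberPoint φ) rfl a = 0) : a = 0 := by
  obtain ⟨U, hxU, e', hval, hc⟩ := exists_continuous_eigenBasis_nhds x e
  obtain ⟨V, hVU, hxV, s, rfl⟩ := (muTildeSheafRS n d).presheaf.exists_le_germ_eq a
    (V := U) hxU
  let g := sectionEquiv (U := V) n (fun y => e' ⟨y.1, hVU y.2⟩)
    (hc.comp (continuous_subtype_val.subtype_mk _)) s
  have hgx : g ⟨x, hxV⟩ = 0 := funext fun φ => by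
    rw [sectionEquiv_apply]
    simp only [fiberPoint_eq_of_val_eq (e.val_injective x.2) hval]
    exact (evalStalk_germ _ _ _ _ _ _).symm.trans (ha φ)
  let N : Opens (TopCat.of (glrs d)) := imageOpens (U := V) ⟨g ⁻¹' {0}, g.isLocallyConstant {0}⟩
  have hNV : N ≤ V := imageOpens_le _
  have hs : (muTildeSheafRS n d).presheaf.map (homOfLE hNV).op s = 0 := by
    refine section_ext ?_
    rintro _ ⟨y, hy, rfl⟩ F hF
    obtain ⟨φ, rfl⟩ := exists_fiberPoint_eq (e' ⟨y.1, hVU y.2⟩) ((e' _).val_injective y.1.2) F hF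
    exact congrFun hy φ
  rw [← (muTildeSheafRS n d).presheaf.germ_res_apply (homOfLE hNV) x ⟨_, hgx, rfl⟩, hs, map_zero]

theorem exists_evalStalk_fiberPoint_eq {x : glrs d} (e : EigenBasis x.1)
    (c : (Fin d → Fin n) → ℂ) : ∃ a : (muTildeSheafRS n d).presheaf.stalk x,
      ∀ φ, evalStalk (x : TopCat.of (glrs d)) (e.fiberPoint φ) rfl a = c φ := by
  obtain ⟨U, hxU, e', hval, hc⟩ := exists_continuous_eigenBasis_nhds x e
  let s := (sectionEquiv n e' hc).symm (LocallyConstant.const U c)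
  have hs : sectionEquiv n e' hc s ⟨x, hxU⟩ = c := by
    rw [LinearEquiv.apply_symm_apply]
    rfl
  refine ⟨(muTildeSheafRS n d).presheaf.germ (X := TopCat.of (glrs d)) U x hxU s, fun φ => ?_⟩
  refine (evalStalk_germ _ _ _ _ _ _).trans (Eq.trans ?_ (congrFun hs φ))
  rw [sectionEquiv_apply]
  simp only [fiberPoint_eq_of_val_eq (e.val_injective x.2) hval]

/-- Germs at `x` as functions on the fibre of `muTilde` over `x`, whose points are numbered by an
eigenbasis. -/
def stalkEquiv (n : ℕ) {x : glrs d} (e : EigenBasis x.1) :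
    (muTildeSheafRS n d).presheaf.stalk x ≃ₗ[ℂ] ((Fin d → Fin n) → ℂ) :=
  LinearEquiv.ofBijective
    (LinearMap.pi fun φ => evalStalk (x : TopCat.of (glrs d)) (e.fiberPoint φ) rfl)
    ⟨(injective_iff_map_eq_zero _).2 fun _ ha =>
      eq_zero_of_evalStalk_fiberPoint_eq_zero e (congrFun ha),
    fun c => (exists_evalStalk_fiberPoint_eq e c).imp fun _ => funext⟩

end Sections

/-! ### Monodromy of germs -/

theorem monodromyAction_mk {X : TopCat.{0}} [LocallyConnectedSpace X]
    {F : X.Sheaf (ModuleCat.{0} ℂ)} (hF : IsLocalSystem F) {x : X} (γ : Path x x)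
    (a : F.presheaf.stalk x) :
    (⟨x, monodromyAction hF x (FundamentalGroup.fromPath (Path.Homotopic.Quotient.mk γ)) a⟩ :
      F.presheaf.EtaleSpace) = hF.isCoveringMap.liftPath γ.toContinuousMap ⟨x, a⟩ γ.source 1 :=
  congrArg Subtype.val ((fiberEquivStalk F x).symm_apply_apply
    (hF.isCoveringMap.monodromy (Path.Homotopic.Quotient.mk γ) ⟨⟨x, a⟩, rfl⟩))

section Monodromy

variable {n d : ℕ}

/-- The value of a point of the étalé space, i.e. of a germ, at a point of the fibre over its
base point. -/
def evalEtale (p : (muTildeSheafRS n d).presheaf.EtaleSpace) (F : Mperp n d)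
    (h : F.1.1 = (show glrs d from p.base).1) : ℂ :=
  evalStalk p.base F h p.germ

theorem isLocallyConstant_evalEtale {T : Type*} [TopologicalSpace T]
    {p : T → (muTildeSheafRS n d).presheaf.EtaleSpace} (hp : Continuous p) {F : T → Mperp n d}
    (hF : Continuous F) (h : ∀ t, (F t).1.1 = (show glrs d from (p t).base).1) :
    IsLocallyConstant fun t => evalEtale (p t) (F t) (h t) := by
  refine IsLocallyConstant.iff_eventually_eq _ |>.2 fun t₀ => ?_
  obtain ⟨V, hV, s, hs⟩ := (muTildeSheafRS n d).presheaf.exists_germ_eq (p t₀).germ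
  have heval : ∀ t (ht : (p t).base ∈ V), (p t).germ =
      (muTildeSheafRS n d).presheaf.germ V (p t).base ht s →
        evalEtale (p t) (F t) (h t) = evalAt s (p t).base ht (F t) (h t) := fun t ht hts => by
    rw [evalEtale, hts, evalStalk_germ]
  have hloc : IsLocallyConstant fun t : {t | (p t).base ∈ V} =>
      evalAt s (p t.1).base t.2 (F t.1) (h t.1) :=
    isLocallyConstant_evalAt s (hF.comp continuous_subtype_val) _ _
  have hconst := hloc.eventually_eq ⟨t₀, hV⟩
  rw [nhds_subtype_eq_comap, Filter.eventually_comap] at hconst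
  filter_upwards [hp.continuousAt.eventually ((p t₀).eventually_nhds hV s hs), hconst]
    with t ⟨htV, hts⟩ ht
  rw [heval t htV hts, heval t₀ hV hs.symm]
  exact ht ⟨t, htV⟩ rfl

theorem stalkEquiv_apply {x : glrs d} (e : EigenBasis x.1)
    (a : (muTildeSheafRS n d).presheaf.stalk x) (φ : Fin d → Fin n) :
    stalkEquiv n e a φ = evalEtale ⟨x, a⟩ (e.fiberPoint φ) rfl := rfl

theorem evalEtale_lift {x y : glrs d} (γ : Path x y)
    (Γ : C(unitInterval, (muTildeSheafRS n d).presheaf.EtaleSpace))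
    (hΓ : ∀ t, (Γ t).base = γ t) (e : ∀ t, EigenBasis (γ t).1)
    (hec : Continuous fun t => (e t).val) (φ : Fin d → Fin n) {F₀ F₁ : Mperp n d}
    (h₀ : (e 0).fiberPoint φ = F₀) (h₁ : (e 1).fiberPoint φ = F₁)
    {p₀ p₁ : (muTildeSheafRS n d).presheaf.EtaleSpace} (hp₀ : Γ 0 = p₀) (hp₁ : Γ 1 = p₁)
    (hb₀ : F₀.1.1 = (show glrs d from p₀.base).1) (hb₁ : F₁.1.1 = (show glrs d from p₁.base).1) :
    evalEtale p₁ F₁ hb₁ = evalEtale p₀ F₀ hb₀ := by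
  subst h₀ h₁ hp₀ hp₁
  exact (isLocallyConstant_evalEtale Γ.continuous
    (continuous_fiberPoint (continuous_subtype_val.comp γ.continuous) e
      (fun t => (e t).val_injective (γ t).2) hec φ)
    (fun t => congrArg Subtype.val (hΓ t).symm)).apply_eq_of_preconnectedSpace 1 0

theorem fiberPoint_congr {x x' : gl d} (hx : x' = x) {e : EigenBasis x} {e' : EigenBasis x'}
    (he : Function.Injective e.val) (h : e'.val = e.val) (φ : Fin d → Fin n) :
    e'.fiberPoint φ = e.fiberPoint φ := by
  subst hx
  exact fiberPoint_eq_of_val_eq he h φ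

theorem stalkEquiv_monodromyAction (hL : IsLocalSystem (muTildeSheafRS n d)) {x : glrs d}
    (e : EigenBasis x.1) (γ : FundamentalGroup (glrs d) x)
    (a : (muTildeSheafRS n d).presheaf.stalk x) (φ : Fin d → Fin n) :
    stalkEquiv n e (monodromyAction hL x γ a) φ = stalkEquiv n e a (φ ∘ e.permHom γ) := by
  obtain ⟨γ, rfl⟩ := Path.Homotopic.Quotient.mk_surjective γ
  set σ := e.permHom (FundamentalGroup.fromPath (Path.Homotopic.Quotient.mk γ))
  obtain ⟨e', he0, hec⟩ := exists_continuous_eigenBasis_path γ e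
  have he1 : (e' 1).val = (e.reindex σ).val := funext fun i =>
    (e.val_permHom γ ⟨fun t => (e' t).val i, by fun_prop⟩
      (fun t => (e' t).hasEigenvalue_iff.2 ⟨i, rfl⟩) (congrFun he0 i)).symm
  have hF0 : (e' 0).fiberPoint (φ ∘ σ) = e.fiberPoint (φ ∘ σ) :=
    fiberPoint_congr (congrArg Subtype.val γ.source) (e.val_injective x.2) he0 _
  have hF1 : (e' 1).fiberPoint (φ ∘ σ) = e.fiberPoint φ := by
    rw [fiberPoint_congr (congrArg Subtype.val γ.target) ((e.reindex σ).val_injective x.2) he1,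
      e.fiberPoint_reindex, Function.comp_assoc, Equiv.self_comp_symm, Function.comp_id]
  rw [stalkEquiv_apply, stalkEquiv_apply]
  exact evalEtale_lift γ _
    (fun t => congrFun (hL.isCoveringMap.liftPath_lifts γ.toContinuousMap ⟨x, a⟩ γ.source) t)
    e' hec (φ ∘ σ) hF0 hF1 (hL.isCoveringMap.liftPath_zero _ _ _) (monodromyAction_mk hL γ a).symm
    rfl rfl

end Monodromy

/-! ### Surjectivity onto the symmetric group -/

theorem joinedIn_setOf_ne_zero {E : Type*} [AddCommGroup E] [Module ℂ E] [TopologicalSpace E]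
    [ContinuousAdd E] [ContinuousSMul ℂ E] {g : E → ℂ}
    (hg : ∀ a b : E, ∃ q : ℂ[X], ∀ z : ℂ, q.eval z = g (a + z • b)) {a b : E}
    (ha : g a ≠ 0) (hb : g b ≠ 0) : JoinedIn {v | g v ≠ 0} a b := by
  obtain ⟨q, hq⟩ := hg a (b - a)
  have hq0 : q.eval 0 ≠ 0 := by simpa [hq] using ha
  have hq1 : q.eval 1 ≠ 0 := by simpa [hq] using hb
  have hroots : {z | q.eval z = 0}.Countable :=
    (finite_setOfPred_isRoot (ne_of_apply_ne (eval 0) (by simpa using hq0))).countable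
  obtain ⟨δ, hδ⟩ := (hroots.isPathConnected_compl_of_one_lt_rank
    (by rw [Complex.rank_real_complex]; norm_num)).joinedIn 0 hq0 1 hq1
  exact ⟨(δ.map (f := fun z => a + z • (b - a)) (by fun_prop)).cast (by simp) (by simp),
    fun t => by simpa [hq] using hδ t⟩

theorem joinedIn_det_ne_zero {ι : Type*} [Fintype ι] [DecidableEq ι] {P Q : Matrix ι ι ℂ}
    (hP : P.det ≠ 0) (hQ : Q.det ≠ 0) : JoinedIn {R : Matrix ι ι ℂ | R.det ≠ 0} P Q :=
  joinedIn_setOf_ne_zero (fun A B => ⟨(A.map C + (X : ℂ[X]) • B.map C).det, fun z => by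
    rw [← coe_evalRingHom, RingHom.map_det]
    congr 1
    ext i j
    simp [mul_comm z]⟩) hP hQ

theorem joinedIn_injective {d : ℕ} {l l' : Fin d → ℂ} (hl : Function.Injective l)
    (hl' : Function.Injective l') : JoinedIn {m : Fin d → ℂ | Function.Injective m} l l' := by
  simp only [← Matrix.det_vandermonde_ne_zero_iff] at hl hl' ⊢
  refine joinedIn_setOf_ne_zero (fun a b =>
    ⟨(Matrix.vandermonde fun i => C (a i) + X * C (b i)).det, fun z => ?_⟩) hl hl'
  rw [← coe_evalRingHom, RingHom.map_det]
  congr 1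
  ext i j
  simp [Matrix.vandermonde_apply, mul_comm z]

section Surjectivity

variable {d : ℕ}

theorem EigenBasis.exists_conj_diagonal_eq {x : gl d} (e : EigenBasis x) :
    ∃ P : gl d, P.det ≠ 0 ∧ P * Matrix.diagonal e.val * P⁻¹ = x := by
  let b := (EuclideanSpace.basisFun (Fin d) ℂ).toBasis
  have hP : (b.toMatrix e.vec).det ≠ 0 := by
    have := b.invertibleToMatrix e.vec
    exact (Matrix.isUnit_det_of_invertible _).ne_zero
  have hx : x * b.toMatrix e.vec = b.toMatrix e.vec * Matrix.diagonal e.val := by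
    ext i j
    have h := congrArg (fun v : Cd d => v i) (e.apply_vec j)
    rw [Matrix.mul_diagonal]
    simpa [b, Module.Basis.toMatrix_apply, Matrix.mul_apply, Matrix.mulVec, dotProduct, mul_comm]
      using h
  exact ⟨_, hP, by rw [← hx, Matrix.mul_nonsing_inv_cancel_right _ _ hP.isUnit]⟩

theorem charpoly_conj_diagonal {P : gl d} (hP : P.det ≠ 0) (l : Fin d → ℂ) :
    (P * Matrix.diagonal l * P⁻¹).charpoly = ∏ i, (X - C (l i)) := by
  rw [Matrix.charpoly_mul_comm, Matrix.nonsing_inv_mul_cancel_left _ _ hP.isUnit,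
    Matrix.charpoly_diagonal]

theorem exists_path_eigenvalues {x y : glrs d} (e : EigenBasis x.1) (e' : EigenBasis y.1) :
    ∃ (γ : Path x y) (l : Path e.val e'.val),
      ∀ t i, Module.End.HasEigenvalue (Matrix.toEuclideanLin (γ t).1) (l t i) := by
  obtain ⟨P, hP, hPx⟩ := e.exists_conj_diagonal_eq
  obtain ⟨P', hP', hPy⟩ := e'.exists_conj_diagonal_eq
  obtain ⟨Q, hQ⟩ := joinedIn_det_ne_zero hP hP'
  obtain ⟨l, hl⟩ := joinedIn_injective (e.val_injective x.2) (e'.val_injective y.2)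
  let z (t : unitInterval) : gl d := Q t * Matrix.diagonal (l t) * (Q t)⁻¹
  have hz (t) : (z t).charpoly = ∏ i, (X - C (l t i)) := charpoly_conj_diagonal (hQ t) _
  have hzrs (t) : IsRegularSemisimple (z t) := by
    rw [isRegularSemisimple_iff, hz, separable_prod_X_sub_C_iff]
    exact hl t
  have hzc : Continuous z := by
    refine (Q.continuous.matrix_mul l.continuous.matrix_diagonal).matrix_mul ?_
    simp only [Matrix.inv_def, Ring.inverse_eq_inv']
    exact (Q.continuous.matrix_det.inv₀ hQ).smul Q.continuous.matrix_adjugate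
  refine ⟨⟨⟨fun t => ⟨z t, hzrs t⟩, hzc.subtype_mk _⟩, Subtype.ext ?_, Subtype.ext ?_⟩, l,
    fun t i => ?_⟩
  · simpa [z] using hPx
  · simpa [z] using hPy
  · change Module.End.HasEigenvalue (Matrix.toEuclideanLin (z t)) (l t i)
    rw [hasEigenvalue_toEuclideanLin_iff, hz, isRoot_prod]
    exact ⟨i, Finset.mem_univ i, by simp⟩

theorem EigenBasis.permHom_surjective {x : glrs d} (e : EigenBasis x.1) :
    Function.Surjective e.permHom := by
  intro σ
  obtain ⟨γ, l, hl⟩ := exists_path_eigenvalues e (e.reindex σ)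
  refine ⟨FundamentalGroup.fromPath (Path.Homotopic.Quotient.mk γ),
    Equiv.ext fun i => e.val_injective x.2 ?_⟩
  rw [e.val_permHom γ ⟨fun t => l t i, by fun_prop⟩ (fun t => hl t i) (congrFun l.source i)]
  exact congrFun l.target i

end Surjectivity

/-! ### The tensor power -/

theorem tensorPerm_sum {n d : ℕ} (f : Fin n → Fin n → ℂ) (σ : Equiv.Perm (Fin d))
    (c : (Fin d → Fin n) → ℂ) :
    tensorPerm n d σ (∑ φ, c φ • PiTensorProduct.tprod ℂ fun i => f (φ i)) =
      ∑ φ : Fin d → Fin n, c (φ ∘ σ) • PiTensorProduct.tprod ℂ fun i => f (φ i) := by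
  rw [map_sum]
  refine Fintype.sum_equiv (σ.arrowCongr (Equiv.refl _)) _ _ fun φ => ?_
  have h : σ.arrowCongr (Equiv.refl (Fin n)) φ ∘ σ = φ := by
    funext i
    simp [Equiv.arrowCongr]
  rw [map_smul, h]
  congr 1
  exact PiTensorProduct.reindex_tprod (s := fun _ => Fin n → ℂ) σ fun i => f (φ i)

end FlagMonodromy

end

theorem lemma10p2 (n d : ℕ) (hn : 1 ≤ n) (hd : 1 ≤ d) (x : glrs d) (e : EigenBasis x.1) :
    ∃ hL : IsLocalSystem (muTildeSheafRS n d),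
    ∃ ρ : FundamentalGroup (glrs d) x →* Equiv.Perm (Fin d),
      Function.Surjective ρ ∧
      (∀ (γ : Path x x) (i : Fin d), ∃ l : C(unitInterval, ℂ),
        l 0 = e.val i ∧
        (∀ t, Module.End.HasEigenvalue (Matrix.toEuclideanLin (γ t).1) (l t)) ∧
        l 1 = e.val (ρ (FundamentalGroup.fromPath (Path.Homotopic.Quotient.mk γ)) i)) ∧
      ∀ f : Module.Basis (Fin n) ℂ (Fin n → ℂ),
        ∃ T : (muTildeSheafRS n d).presheaf.stalk x ≃ₗ[ℂ] (⨂[ℂ] _ : Fin d, (Fin n → ℂ)),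
          (∀ (U : Opens (glrs d)) (hx : x ∈ U) (s : (muTildeSheafRS n d).presheaf.obj (op U)),
            T ((muTildeSheafRS n d).presheaf.germ U x hx s) =
              ∑ φ : Fin d → Fin n, evalAt s x hx (e.fiberPoint φ) rfl •
                PiTensorProduct.tprod ℂ (fun i => f (φ i))) ∧
          ∀ (γ : FundamentalGroup (glrs d) x) (a : (muTildeSheafRS n d).presheaf.stalk x),
            T (monodromyAction hL x γ a) = tensorPerm n d (ρ γ) (T a) := by
  have hL := isLocalSystem_muTildeSheafRS n d
  refine ⟨hL, e.permHom, e.permHom_surjective, fun γ i => ?_, fun f => ?_⟩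
  · obtain ⟨l, hl0, hl⟩ := exists_eigenvalue_lift γ (e.hasEigenvalue_iff.2 ⟨i, rfl⟩)
    exact ⟨l, hl0, hl, (e.val_permHom γ l hl hl0).symm⟩
  · let b := Basis.piTensorProduct fun _ : Fin d => f
    let T := (stalkEquiv n e).trans b.equivFun.symm
    have hT : ∀ a, T a = ∑ φ : Fin d → Fin n,
        stalkEquiv n e a φ • PiTensorProduct.tprod ℂ (fun i => f (φ i)) := fun a => by
      simp only [T, b, LinearEquiv.trans_apply, Module.Basis.equivFun_symm_apply,
        Basis.piTensorProduct_apply]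
    refine ⟨T, fun U hx s => ?_, fun γ a => ?_⟩
    · rw [hT]
      exact Finset.sum_congr rfl fun φ _ => congrArg (· • _) (evalStalk_germ _ _ _ _ _ _)
    · rw [hT, hT, tensorPerm_sum]
      exact Finset.sum_congr rfl fun φ _ =>
        congrArg (· • _) (stalkEquiv_monodromyAction hL e γ a φ)
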